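/- Let $F$ be a field. A finite separable extension $E$ of $F$ is called primitive if $[E:F]>1$ and the only intermediate fields $F\subseteq K\subseteq E$ are $F$ and $E$; it is primitive quartic if moreover $[E:F]=4$. The Galois closure of $E$ over $F$ is denoted $\hat E$. For a finite group $S$, an $S$-extension of $F$ is a Galois extension $D$ of $F$ with $\mathrm{Gal}(D|F)\cong S$. (a) Let $E$ be a separable extension of $F$ of degree $4$. Then $E$ is primitive if and only if $\mathrm{Gal}(\hat E|F)$ is isomorphic to $A_4$ or to $S_4$. If $E$ is primitive, then $\mathrm{Gal}(\hat E|F)$ is solvable. (b) The set $\mathbf P_1(\mathbf F_2)$ of lines through the origin in $\mathbf F_2^2$ has three elements, and the action of $\mathrm{GL}_2(\mathbf F_2)$ on it identifies $\mathrm{GL}_2(\mathbf F_2)$ with the symmetric group $S_3$ of $\mathbf P_1(\mathbf F_2)$. Under this identification, the only subgroups of $S_3$ for which the module $\mathbf F_2^2$ is simple are $A_3$ and $S_3$. For the resulting actions on $\mathbf F_2^2$ one has $A_4\cong\mathbf F_2^2\rtimes A_3$ and $S_4\cong\mathbf F_2^2\rtimes S_3$. (c) For every $A_4$- or $S_4$-extension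 $D$ of $F$ there is a primitive quartic extension $E$ of $F$ of which $D$ is the Galois closure, and $E$ is unique up to $F$-isomorphism. -/

import Mathlib

universe u v w

open scoped LinearAlgebra.Projectivization

/-- A finite separable extension `E` of `F` is *primitive* if `[E : F] > 1` and the only
intermediate fields are `F` and `E`. -/
structure IsPrimitiveExtension (F E : Type*) [Field F] [Field E] [Algebra F E] : Prop where
  finiteDimensional : FiniteDimensional F E
  isSeparable : Algebra.IsSeparable F E
  one_lt_finrank : 1 < Module.finrank F E
  eq_bot_or_eq_top : ∀ K : IntermediateField F E, K = ⊥ ∨ K = ⊤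

/-- A primitive quartic extension: a primitive extension of degree `4`. -/
structure IsPrimitiveQuartic (F E : Type*) [Field F] [Field E] [Algebra F E] : Prop where
  isPrimitive : IsPrimitiveExtension F E
  finrank_eq : Module.finrank F E = 4

/-- `D` is an `S`-extension of `F`: galoisian, with Galois group isomorphic to `S`. -/
structure IsGaloisWithGroup (F D : Type*) [Field F] [Field D] [Algebra F D]
    (S : Type*) [Group S] : Prop where
  isGalois : IsGalois F D
  nonempty_mulEquiv : Nonempty (Gal(D/F) ≃* S)

namespace PlaneF2

/-- The plane `𝔽₂²`. -/
abbrev V : Type := Fin 2 → ZMod 2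

/-- The group `GL₂(𝔽₂)`, as the group of linear automorphisms of the plane. -/
abbrev GL2 : Type := LinearMap.GeneralLinearGroup (ZMod 2) V

/-- `ℙ₁(𝔽₂)`, the set of lines through the origin in `𝔽₂²`. -/
abbrev Line : Type := ℙ (ZMod 2) V

open Classical in
/-- The alternating group on the set `ℙ₁(𝔽₂)`, that is, `A₃`. -/
noncomputable def altLine : Subgroup (Equiv.Perm Line) :=
  letI : Fintype Line := Fintype.ofFinite Line
  alternatingGroup Line

/-- The tautological representation of `GL₂(𝔽₂)` on `𝔽₂²`. -/
def stdRep : Representation (ZMod 2) GL2 V :=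
  Units.coeHom (Module.End (ZMod 2) V)

/-- The representation on `𝔽₂²` of a subgroup `H` of the symmetric group of `ℙ₁(𝔽₂)`, via an
identification `e` of `GL₂(𝔽₂)` with that symmetric group. -/
def rep (e : GL2 ≃* Equiv.Perm Line) (H : Subgroup (Equiv.Perm Line)) :
    Representation (ZMod 2) H V :=
  stdRep.comp (e.symm.toMonoidHom.comp H.subtype)

/-- `GL₂(𝔽₂)` acting by automorphisms on the additive group of `𝔽₂²`, written
multiplicatively. -/
def mulAutHom : GL2 →* MulAut (Multiplicative V) where
  toFun g := AddEquiv.toMultiplicative g.toLinearEquiv.toAddEquiv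
  map_one' := rfl
  map_mul' _ _ := rfl

/-- The action by group automorphisms underlying the representation `rep e H`. -/
def action (e : GL2 ≃* Equiv.Perm Line) (H : Subgroup (Equiv.Perm Line)) :
    H →* MulAut (Multiplicative V) :=
  mulAutHom.comp (e.symm.toMonoidHom.comp H.subtype)

/-- The action of `H` on the group `𝔽₂²` is by the operators of the representation `rep e H`. -/
theorem action_apply (e : GL2 ≃* Equiv.Perm Line) (H : Subgroup (Equiv.Perm Line)) (h : H)
    (v : V) : action e H h (Multiplicative.ofAdd v) = Multiplicative.ofAdd (rep e H h v) :=
  rfl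

end PlaneF2

/-! By the Galois correspondence, a quartic `E` with closure `L` is a core-free subgroup `H` of
index 4 in `G = Gal(L/F)`, and `E` is primitive exactly when `H` is maximal. Acting on `G ⧸ H`
embeds `G` in `S₄`, so `|H|` divides 6. Maximality rules out orders 1 and 2, since such an `H` sits
with index 2 in a larger 2-subgroup; hence `G` has order 12 or 24 and is `A₄` or `S₄`. Conversely, a
non-maximal `H` would lie in a subgroup of index 2, which is impossible in `A₄` because 3-cycles are
squares and generate; the case of `S₄` reduces to this.

Uniqueness (`exists_conj_smul_eq_of_isCoatom`): a core-free maximal `H` of index 4 is the normalizer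
of a Sylow 3-subgroup, so all such `H` are conjugate, and conjugate subgroups have isomorphic fixed
fields.

Over `𝔽₂` a line has a single nonzero vector, so `GL₂(𝔽₂)` acts faithfully on the three lines. A
subgroup acts irreducibly exactly when it fixes no line. The affine action on the four points of the
plane embeds the semidirect products in `S₄`, where their orders identify them. -/

/-! ### Maximality of index-four subgroups in alternating and symmetric groups. -/

theorem alternatingGroup.index_ne_two_of_subgroup {α : Type*} [Fintype α] [DecidableEq α]
    (K : Subgroup (alternatingGroup α)) : K.index ≠ 2 := by
  intro h
  have hK : K = ⊤ := by
    rw [eq_top_iff, ← alternatingGroup.closure_isThreeCycles_eq_top, Subgroup.closure_le]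
    intro σ hσ
    have h3 : σ ^ 3 = 1 := by
      apply Subtype.ext
      have : orderOf (σ : Equiv.Perm α) = 3 := Equiv.Perm.IsThreeCycle.orderOf hσ
      rw [Subgroup.coe_pow, ← this, pow_orderOf_eq_one]; rfl
    -- A subgroup of index 2 contains all squares, hence all 3-cycles.
    have : σ = (σ ^ 2) ^ 2 := by
      rw [← pow_mul, show 2 * 2 = 3 + 1 from rfl, pow_succ, h3, one_mul]
    rw [this]
    exact Subgroup.sq_mem_of_index_two h _
  rw [hK, Subgroup.index_top] at h
  omega

theorem Subgroup.isCoatom_of_index_eq_four {G : Type*} [Group G] {H : Subgroup G}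
    (hH : H.index = 4) (h : ∀ K : Subgroup G, H ≤ K → K.index ≠ 2) : IsCoatom H := by
  refine ⟨fun h' => by rw [h', Subgroup.index_top] at hH; omega, fun K hK => ?_⟩
  have h1 := Subgroup.relIndex_mul_index hK.le
  rw [hH] at h1
  have h2 : K.index ∣ 4 := Dvd.intro_left _ h1
  have h3 := h K hK.le
  have h4 : K.index ≠ 4 := by
    intro h4
    rw [h4] at h1
    have : H.relIndex K = 1 := by omega
    exact hK.not_ge (Subgroup.relIndex_eq_one.1 this)
  have h5 : K.index ≤ 4 := Nat.le_of_dvd (by norm_num) h2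
  rw [← Subgroup.index_eq_one]
  interval_cases K.index <;> omega

theorem isCoatom_of_index_eq_four_alternatingGroup {α : Type*} [Fintype α] [DecidableEq α]
    {H : Subgroup (alternatingGroup α)} (hH : H.index = 4) : IsCoatom H :=
  Subgroup.isCoatom_of_index_eq_four hH
    fun K _ => alternatingGroup.index_ne_two_of_subgroup K

/-- An index-2 subgroup above `H` must be the alternating group, in which `H` would then have index
2. -/
theorem isCoatom_of_index_eq_four_perm {α : Type*} [Fintype α] [DecidableEq α]
    {H : Subgroup (Equiv.Perm α)} (hH : H.index = 4) : IsCoatom H := by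
  refine Subgroup.isCoatom_of_index_eq_four hH fun K hK h2 => ?_
  have h1 := Subgroup.relIndex_mul_index hK
  rw [hH, h2] at h1
  obtain rfl := Equiv.Perm.eq_alternatingGroup_of_index_eq_two h2
  exact alternatingGroup.index_ne_two_of_subgroup (H.subgroupOf (alternatingGroup α))
    (show H.relIndex _ = 2 by omega)

theorem Subgroup.isCoatom_of_mulEquiv {G G' : Type*} [Group G] [Group G'] (e : G ≃* G')
    (h : ∀ H' : Subgroup G', H'.index = 4 → IsCoatom H') {H : Subgroup G} (hH : H.index = 4) :
    IsCoatom H := by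
  rw [← OrderIso.isCoatom_iff e.mapSubgroup]
  refine h _ ?_
  rw [← hH]
  exact Subgroup.index_map_equiv H e

/-! ### Core-free maximal subgroups of index four. -/

theorem exists_injective_hom_perm_fin_four {G : Type*} [Group G] {H : Subgroup G}
    (hH : H.index = 4) (hc : H.normalCore = ⊥) :
    ∃ f : G →* Equiv.Perm (Fin 4), Function.Injective f := by
  have : Finite (G ⧸ H) := Nat.finite_of_card_ne_zero (by rw [← Subgroup.index, hH]; norm_num)
  let e : G ⧸ H ≃ Fin 4 := Finite.equivFinOfCardEq hH
  refine ⟨e.permCongrHom.toMonoidHom.comp (MulAction.toPermHom G (G ⧸ H)), ?_⟩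
  refine e.permCongrHom.injective.comp ?_
  rw [← MonoidHom.ker_eq_bot_iff, ← Subgroup.normalCore_eq_ker, hc]

theorem card_perm_fin_four : Nat.card (Equiv.Perm (Fin 4)) = 24 := by
  rw [Nat.card_perm, Nat.card_fin]; rfl

/-- A core-free maximal subgroup of index `4` has `3` or `6` elements. -/
theorem card_eq_three_or_six_of_isCoatom {G : Type*} [Group G] {H : Subgroup G}
    (hH : H.index = 4) (hc : H.normalCore = ⊥) (hm : IsCoatom H) :
    Nat.card H = 3 ∨ Nat.card H = 6 := by
  obtain ⟨f, hf⟩ := exists_injective_hom_perm_fin_four hH hc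
  have : Finite G := Finite.of_injective f hf
  have hcard := H.card_mul_index
  rw [hH] at hcard
  have hdvd := Subgroup.card_dvd_of_injective f hf
  rw [card_perm_fin_four, ← hcard] at hdvd
  have h6 : Nat.card H ∣ 6 := (Nat.mul_dvd_mul_iff_right (by norm_num : 0 < 4)).1 hdvd
  -- By Sylow, `H` of order `2 ^ n` lies in some `K` of order `2 ^ (n + 1)`; this is strictly
  -- between `H` and `G`, which has order `2 ^ (n + 2)`.
  have key : ∀ n, Nat.card H = 2 ^ n → n ≤ 1 → False := by
    intro n hn hn1
    have hd : 2 ^ (n + 1) ∣ Nat.card G := by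
      rw [← hcard, hn, pow_succ]; exact mul_dvd_mul_left _ (by norm_num)
    obtain ⟨K, hK, hHK⟩ := Sylow.exists_subgroup_card_pow_succ hd hn
    rcases hm.le_iff.1 hHK with h | h
    · rw [h, Subgroup.card_top, ← hcard, hn, pow_succ] at hK
      have := pow_pos (two_pos : 0 < 2) n
      omega
    · rw [h, hn, pow_succ] at hK
      have := pow_pos (two_pos : 0 < 2) n
      omega
  have hle := Nat.le_of_dvd (by norm_num) h6
  have h1 : Nat.card H ≠ 1 := fun h => key 0 (by rw [h, pow_zero]) zero_le_one
  have h2 : Nat.card H ≠ 2 := fun h => key 1 (by rw [h, pow_one]) le_rfl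
  have h0 : Nat.card H ≠ 0 := Nat.card_pos.ne'
  generalize Nat.card H = n at *
  interval_cases n <;> omega

theorem nonempty_mulEquiv_of_isCoatom {G : Type*} [Group G] {H : Subgroup G}
    (hH : H.index = 4) (hc : H.normalCore = ⊥) (hm : IsCoatom H) :
    Nonempty (G ≃* alternatingGroup (Fin 4)) ∨ Nonempty (G ≃* Equiv.Perm (Fin 4)) := by
  obtain ⟨f, hf⟩ := exists_injective_hom_perm_fin_four hH hc
  have hcard := H.card_mul_index
  have hr : Nat.card f.range = Nat.card G := (Nat.card_congr (f.ofInjective hf).toEquiv).symm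
  have hi := f.range.card_mul_index
  rw [card_perm_fin_four, hr, ← hcard, hH] at hi
  rcases card_eq_three_or_six_of_isCoatom hH hc hm with h | h <;> rw [h] at hi
  · left
    have : f.range = alternatingGroup (Fin 4) :=
      Equiv.Perm.eq_alternatingGroup_of_index_eq_two (by omega)
    exact ⟨(f.ofInjective hf).trans (MulEquiv.subgroupCongr this)⟩
  · right
    have : f.range = ⊤ := Subgroup.index_eq_one.1 (by omega)
    exact ⟨(f.ofInjective hf).trans ((MulEquiv.subgroupCongr this).trans Subgroup.topEquiv)⟩

theorem isSolvable_perm_of_isSolvable_alternatingGroup (α : Type*) [Fintype α] [DecidableEq α]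
    [Group.IsSolvable (alternatingGroup α)] : Group.IsSolvable (Equiv.Perm α) := by
  refine Group.isSolvable_of_ker_le_range (alternatingGroup α).subtype
    (Equiv.Perm.sign (α := α)) ?_
  rw [Subgroup.range_subtype]
  exact le_rfl

theorem isSolvable_perm_fin_four : Group.IsSolvable (Equiv.Perm (Fin 4)) := by
  have h4 : Nat.card (Fin 4) = 4 := Nat.card_fin 4
  have : Group.IsSolvable (alternatingGroup (Fin 4)) := by
    -- The derived subgroup of `A₄` is the Klein four-group, which is abelian.
    have := alternatingGroup.kleinFour_eq_commutator h4
    have hk := alternatingGroup.kleinFour_isKleinFour h4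
    rw [this] at hk
    rw [Group.isSolvable_def]
    refine ⟨2, ?_⟩
    rw [derivedSeries_succ, derivedSeries_one, Subgroup.commutator_eq_bot_iff_le_centralizer]
    intro x hx
    rw [Subgroup.mem_centralizer_iff]
    intro y hy
    have := IsKleinFour.isMulCommutative (G := commutator (alternatingGroup (Fin 4)))
    exact congrArg Subtype.val (this.is_comm.comm ⟨y, hy⟩ ⟨x, hx⟩)
  exact isSolvable_perm_of_isSolvable_alternatingGroup (Fin 4)

/-- A group of order 3 or 6 has a normal Sylow 3-subgroup, and it is still Sylow in `G` because 3
does not divide the index 4. Its normalizer contains `H`, so it is `H` or `G`; the latter would put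
a group of order 3 in the trivial core. -/
theorem exists_sylow_three_normalizer_eq {G : Type*} [Group G] [Finite G] {H : Subgroup G}
    (hH : H.index = 4) (hc : H.normalCore = ⊥) (hm : IsCoatom H) :
    ∃ P : Sylow 3 G, Subgroup.normalizer (P : Set G) = H := by
  have h36 := card_eq_three_or_six_of_isCoatom hH hc hm
  obtain ⟨Q⟩ : Nonempty (Sylow 3 H) := inferInstance
  have hQ : Nat.card Q = 3 := by
    rw [Q.card_eq_multiplicity]
    rcases h36 with h | h <;> rw [h]
    · rw [Nat.Prime.factorization_self Nat.prime_three, pow_one]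
    · rw [show 6 = 2 * 3 from rfl, Nat.factorization_mul (by norm_num) (by norm_num)]
      simp [Nat.prime_two.factorization, Nat.prime_three.factorization]
  have hQn : (Q : Subgroup H).Normal := by
    have hi := (Q : Subgroup H).card_mul_index
    rw [hQ] at hi
    rcases h36 with h | h <;> rw [h] at hi
    · rw [Subgroup.index_eq_one.1 (show (Q : Subgroup H).index = 1 by omega)]
      infer_instance
    · exact Subgroup.normal_of_index_eq_two (by omega)
  let P' : Subgroup G := (Q : Subgroup H).map H.subtype
  have hP' : Nat.card P' = 3 := by
    rw [← hQ]
    exact (Nat.card_congr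
      ((Q : Subgroup H).equivMapOfInjective _ H.subtype_injective).toEquiv).symm
  have hG : Nat.card G = Nat.card H * 4 := by rw [← hH, H.card_mul_index]
  have hmul : Nat.card P' = 3 ^ (Nat.card G).factorization 3 := by
    rw [hP', hG]
    rcases h36 with h | h <;> rw [h]
    · rw [show 3 * 4 = 3 * 4 from rfl, Nat.factorization_mul (by norm_num) (by norm_num)]
      simp [Nat.prime_three.factorization,
        Nat.factorization_eq_zero_of_not_dvd (show ¬ 3 ∣ 4 by norm_num)]
    · rw [show 6 * 4 = 3 * 8 from rfl, Nat.factorization_mul (by norm_num) (by norm_num)]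
      simp [Nat.prime_three.factorization,
        Nat.factorization_eq_zero_of_not_dvd (show ¬ 3 ∣ 8 by norm_num)]
  refine ⟨Sylow.ofCard P' hmul, ?_⟩
  change Subgroup.normalizer (P' : Set G) = H
  have hle : H ≤ Subgroup.normalizer (P' : Set G) := by
    have := Subgroup.le_normalizer_map (H := (Q : Subgroup H)) H.subtype
    rwa [Subgroup.normalizer_eq_top, ← MonoidHom.range_eq_map, Subgroup.range_subtype] at this
  rcases hm.le_iff.1 hle with h | h
  · have hn : P'.Normal := Subgroup.normalizer_eq_top_iff.1 h
    have : P' ≤ H.normalCore :=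
      Subgroup.normal_le_normalCore.2 (Subgroup.map_subtype_le _)
    rw [hc, le_bot_iff] at this
    rw [this, Subgroup.card_bot] at hP'
    omega
  · exact h

open scoped Pointwise in
theorem exists_conj_smul_eq_of_isCoatom {G : Type*} [Group G] [Finite G] {H K : Subgroup G}
    (hH : H.index = 4) (hHc : H.normalCore = ⊥) (hHm : IsCoatom H)
    (hK : K.index = 4) (hKc : K.normalCore = ⊥) (hKm : IsCoatom K) :
    ∃ g : G, MulAut.conj g • H = K := by
  obtain ⟨P, rfl⟩ := exists_sylow_three_normalizer_eq hH hHc hHm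
  obtain ⟨Q, rfl⟩ := exists_sylow_three_normalizer_eq hK hKc hKm
  obtain ⟨g, rfl⟩ := MulAction.exists_smul_eq G P Q
  refine ⟨g, ?_⟩
  exact Subgroup.map_equiv_normalizer_eq (P : Subgroup G) (MulAut.conj g)

/-- The stabilizer of a point in a transitive subgroup of `S₄` is core-free of index `4`. -/
theorem exists_subgroup_index_four {G : Type*} [Group G] (f : G →* Equiv.Perm (Fin 4))
    (hf : Function.Injective f) (ht : ∀ i : Fin 4, ∃ g, f g 0 = i) :
    ∃ H : Subgroup G, H.index = 4 ∧ H.normalCore = ⊥ := by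
  let : MulAction G (Fin 4) := MulAction.compHom _ f
  have hp : MulAction.orbit G (0 : Fin 4) = Set.univ := by
    ext i
    exact iff_of_true (ht i) trivial
  refine ⟨MulAction.stabilizer G (0 : Fin 4), ?_, ?_⟩
  · rw [MulAction.index_stabilizer, hp, Set.ncard_univ, Nat.card_fin]
  · rw [eq_bot_iff]
    intro g hg
    rw [Subgroup.mem_bot]
    apply hf
    rw [map_one]
    ext1 i
    obtain ⟨k, rfl⟩ := ht i
    -- Conjugates of a core element also fix 0, so `g` itself fixes each point `f k 0`.
    have h1 : f (k⁻¹ * g * k⁻¹⁻¹) 0 = 0 := hg k⁻¹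
    rw [inv_inv, map_mul, map_mul, map_inv] at h1
    rw [Equiv.Perm.mul_apply, Equiv.Perm.mul_apply] at h1
    have h2 := Equiv.Perm.inv_eq_iff_eq.1 h1
    exact h2

/-! ### The plane over `𝔽₂` and its three lines. -/

namespace PlaneF2

theorem finrank_V : Module.finrank (ZMod 2) V = 2 := by
  simp

theorem card_V : Nat.card V = 4 := by
  rw [Nat.card_eq_fintype_card]; rfl

theorem card_line : Nat.card Line = 3 := by
  rw [Projectivization.card_of_finrank_two (ZMod 2) V finrank_V, Nat.card_zmod]

theorem card_GL2 : Nat.card GL2 = 6 := by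
  rw [← Nat.card_congr (Matrix.GeneralLinearGroup.toLin (n := Fin 2) (R := ZMod 2)).toEquiv,
    Matrix.card_GL_field]
  simp [Fin.prod_univ_two]

theorem card_perm_line : Nat.card (Equiv.Perm Line) = 6 := by
  rw [Nat.card_perm, card_line]; rfl

theorem units_eq_one (a : (ZMod 2)ˣ) : a = 1 := by
  revert a; decide

theorem mk_eq_mk_iff_eq {v w : V} (hv : v ≠ 0) (hw : w ≠ 0) :
    Projectivization.mk (ZMod 2) v hv = Projectivization.mk (ZMod 2) w hw ↔ v = w := by
  rw [Projectivization.mk_eq_mk_iff]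
  constructor
  · rintro ⟨a, rfl⟩
    rw [units_eq_one a, one_smul]
  · rintro rfl
    exact ⟨1, one_smul _ _⟩

theorem toPermHom_injective : Function.Injective (MulAction.toPermHom GL2 Line) := by
  rw [injective_iff_map_eq_one]
  intro g hg
  apply Units.ext
  refine LinearMap.ext fun v => ?_
  by_cases hv : v = 0
  · rw [hv, map_zero, map_zero]
  · have h1 : g • Projectivization.mk (ZMod 2) v hv = Projectivization.mk (ZMod 2) v hv :=
      Equiv.ext_iff.1 hg (Projectivization.mk (ZMod 2) v hv)
    rw [Projectivization.smul_mk, mk_eq_mk_iff_eq] at h1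
    exact h1

theorem toPermHom_bijective : Function.Bijective (MulAction.toPermHom GL2 Line) := by
  rw [Nat.bijective_iff_injective_and_card]
  exact ⟨toPermHom_injective, by rw [card_GL2, card_perm_line]⟩

/-- `GL₂(𝔽₂)` is the symmetric group of the set of three lines. -/
noncomputable def permEquiv : GL2 ≃* Equiv.Perm Line :=
  MulEquiv.ofBijective (MulAction.toPermHom GL2 Line) toPermHom_bijective

theorem permEquiv_apply (g : GL2) (p : Line) : permEquiv g p = g • p := rfl

theorem permEquiv_symm_smul (σ : Equiv.Perm Line) (p : Line) : permEquiv.symm σ • p = σ p := by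
  rw [← permEquiv_apply, MulEquiv.apply_symm_apply]

theorem rep_smul_mk (H : Subgroup (Equiv.Perm Line)) (h : H) {v : V} (hv : v ≠ 0) :
    ∃ hw : rep permEquiv H h v ≠ 0,
      (h : Equiv.Perm Line) (Projectivization.mk (ZMod 2) v hv) =
        Projectivization.mk (ZMod 2) (rep permEquiv H h v) hw := by
  rw [← permEquiv_symm_smul, Projectivization.smul_mk]
  exact ⟨_, rfl⟩

theorem eq_zero_or_eq_of_mem_span {v w : V} (h : w ∈ Submodule.span (ZMod 2) {v}) :
    w = 0 ∨ w = v := by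
  obtain ⟨a, rfl⟩ := Submodule.mem_span_singleton.1 h
  fin_cases a
  · left; exact zero_smul _ _
  · right; exact one_smul _ _

/-- In dimension 2 a proper nonzero invariant subspace is an invariant line. -/
theorem isIrreducible_iff_forall_exists_ne (H : Subgroup (Equiv.Perm Line)) :
    (rep permEquiv H).IsIrreducible ↔ ∀ p : Line, ∃ h ∈ H, h p ≠ p := by
  constructor
  · intro hirr p
    by_contra! hp
    induction p using Projectivization.ind with
    | h v hv =>
      have hfix : ∀ h : H, rep permEquiv H h v = v := fun h => by
        obtain ⟨hw, hh⟩ := rep_smul_mk H h hv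
        rw [hp h h.2, mk_eq_mk_iff_eq] at hh
        exact hh.symm
      let W : Subrepresentation (rep permEquiv H) :=
        ⟨Submodule.span (ZMod 2) {v}, fun h w hw => by
          obtain ⟨a, rfl⟩ := Submodule.mem_span_singleton.1 hw
          rw [map_smul, hfix]
          exact hw⟩
      rcases hirr.eq_bot_or_eq_top W with h | h
      · have : Submodule.span (ZMod 2) {v} = ⊥ := congrArg Subrepresentation.toSubmodule h
        exact hv (Submodule.span_singleton_eq_bot.1 this)
      · have : Submodule.span (ZMod 2) {v} = ⊤ := congrArg Subrepresentation.toSubmodule h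
        have h1 := finrank_span_singleton (K := ZMod 2) hv
        rw [this, finrank_top, finrank_V] at h1
        omega
  · intro h
    have : Nontrivial (Subrepresentation (rep permEquiv H)) := by
      refine ⟨⊥, ⊤, fun h => ?_⟩
      exact bot_ne_top (α := Submodule (ZMod 2) V) (congrArg Subrepresentation.toSubmodule h)
    refine ⟨fun W => ?_⟩
    by_contra! hW
    have hW1 : W.toSubmodule ≠ ⊥ := fun h => hW.1 (Subrepresentation.toSubmodule_injective h)
    have hW2 : W.toSubmodule ≠ ⊤ := fun h => hW.2 (Subrepresentation.toSubmodule_injective h)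
    obtain ⟨v, hvW, hv⟩ := Submodule.exists_mem_ne_zero_of_ne_bot hW1
    have hspan : W.toSubmodule = Submodule.span (ZMod 2) {v} := by
      have hlt := Submodule.finrank_lt hW2
      rw [finrank_V] at hlt
      refine (Submodule.eq_of_le_of_finrank_le
        ((Submodule.span_singleton_le_iff_mem _ _).2 hvW) ?_).symm
      rw [finrank_span_singleton hv]
      omega
    obtain ⟨g, hg, hgp⟩ := h (Projectivization.mk (ZMod 2) v hv)
    obtain ⟨hw, hh⟩ := rep_smul_mk H ⟨g, hg⟩ hv
    apply hgp
    change g _ = _ at hh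
    rw [hh, mk_eq_mk_iff_eq]
    have := W.apply_mem_toSubmodule ⟨g, hg⟩ hvW
    rw [hspan] at this
    exact (eq_zero_or_eq_of_mem_span this).resolve_left hw

theorem card_altLine : Nat.card altLine = 3 := by
  classical
  have : Nontrivial Line := Finite.one_lt_card_iff_nontrivial.1 (by rw [card_line]; norm_num)
  let : Fintype Line := Fintype.ofFinite Line
  have h := two_mul_nat_card_alternatingGroup (α := Line)
  rw [card_perm_line] at h
  have h2 : Nat.card altLine = Nat.card (alternatingGroup Line) := by
    unfold altLine; congr!
  omega

theorem eq_altLine_of_card {H : Subgroup (Equiv.Perm Line)} (h : Nat.card H = 3) :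
    H = altLine := by
  classical
  let : Fintype Line := Fintype.ofFinite Line
  have hi := H.card_mul_index
  rw [h, card_perm_line] at hi
  rw [Equiv.Perm.eq_alternatingGroup_of_index_eq_two (show H.index = 2 by omega)]
  unfold altLine; congr!

/-- The stabilizer of a line has order `6 / 3 = 2`. -/
theorem exists_ne_of_three_le_card {H : Subgroup (Equiv.Perm Line)} (h : 3 ≤ Nat.card H)
    (p : Line) : ∃ g ∈ H, g p ≠ p := by
  by_contra! hp
  have hle : H ≤ MulAction.stabilizer (Equiv.Perm Line) p := fun g hg => hp g hg
  have h1 := (MulAction.stabilizer (Equiv.Perm Line) p).card_mul_index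
  rw [MulAction.index_stabilizer_of_transitive, card_line, card_perm_line] at h1
  have h2 := Subgroup.card_le_of_le hle
  omega

theorem isIrreducible_iff (H : Subgroup (Equiv.Perm Line)) :
    (rep permEquiv H).IsIrreducible ↔ H = altLine ∨ H = ⊤ := by
  rw [isIrreducible_iff_forall_exists_ne]
  constructor
  · intro h
    have hd := H.card_subgroup_dvd_card
    rw [card_perm_line] at hd
    have hle := Nat.le_of_dvd (by norm_num) hd
    have h0 : Nat.card H ≠ 0 := Nat.card_pos.ne'
    -- A 2-group acting on three points has a fixed point.
    have key : ∀ n, Nat.card H ≠ 2 ^ n := by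
      intro n hn
      have hp : IsPGroup 2 H := IsPGroup.of_card hn
      obtain ⟨p, hp⟩ := hp.nonempty_fixed_point_of_prime_not_dvd_card Line
        (by rw [card_line]; norm_num)
      obtain ⟨g, hg, hgp⟩ := h p
      exact hgp (hp ⟨g, hg⟩)
    have h1 := key 0
    have h2 := key 1
    rw [pow_zero] at h1
    rw [pow_one] at h2
    by_cases h3 : Nat.card H = 3
    · exact Or.inl (eq_altLine_of_card h3)
    · right
      apply Subgroup.eq_top_of_card_eq
      rw [card_perm_line]
      generalize Nat.card H = n at *
      interval_cases n <;> omega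
  · rintro (rfl | rfl) p
    · exact exists_ne_of_three_le_card (by rw [card_altLine]) p
    · exact exists_ne_of_three_le_card (by rw [Subgroup.card_top, card_perm_line]; norm_num) p

end PlaneF2

/-! ### Semidirect products as affine groups. -/

/-- The affine action of `N ⋊ H` on `N`: `(n, h)` maps `x` to `n * φ h x`. -/
def SemidirectProduct.affineHom {N H : Type*} [Group N] [Group H] (φ : H →* MulAut N) :
    N ⋊[φ] H →* Equiv.Perm N :=
  SemidirectProduct.lift (MulAction.toPermHom N N)
    ((MulAction.toPermHom (MulAut N) N).comp φ) fun h => by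
      ext n x
      simp [MulAut.smul_def]

theorem SemidirectProduct.affineHom_injective {N H : Type*} [Group N] [Group H]
    {φ : H →* MulAut N} (hφ : Function.Injective φ) : Function.Injective (affineHom φ) := by
  rw [injective_iff_map_eq_one]
  intro x hx
  have h : ∀ n, x.left * φ x.right n = n := fun n => Equiv.ext_iff.1 hx n
  -- The image of the identity of `N` is the translation part.
  have h1 : x.left = 1 := by simpa using h 1
  refine SemidirectProduct.ext h1 (hφ ?_)
  ext n
  simpa [h1] using h n

namespace PlaneF2

theorem action_injective (H : Subgroup (Equiv.Perm Line)) :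
    Function.Injective (action permEquiv H) := by
  refine Function.Injective.comp (g := mulAutHom) ?_
    (permEquiv.symm.injective.comp H.subtype_injective)
  intro g g' h
  apply Units.ext
  refine LinearMap.ext fun v => ?_
  exact congrArg Multiplicative.toAdd (DFunLike.congr_fun h (Multiplicative.ofAdd v))

/-- The affine action of `𝔽₂² ⋊ H` on the four points of the plane. -/
theorem exists_injective_hom (H : Subgroup (Equiv.Perm Line)) :
    ∃ f : Multiplicative V ⋊[action permEquiv H] H →* Equiv.Perm (Fin 4),
      Function.Injective f := by
  let e : Multiplicative V ≃ Fin 4 := Finite.equivFinOfCardEq card_V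
  exact ⟨e.permCongrHom.toMonoidHom.comp (SemidirectProduct.affineHom _),
    e.permCongrHom.injective.comp (SemidirectProduct.affineHom_injective (action_injective H))⟩

theorem card_semidirectProduct (H : Subgroup (Equiv.Perm Line)) :
    Nat.card (Multiplicative V ⋊[action permEquiv H] H) = 4 * Nat.card H := by
  rw [SemidirectProduct.card, show Nat.card (Multiplicative V) = 4 from card_V]

theorem nonempty_alternatingGroup_mulEquiv :
    Nonempty (alternatingGroup (Fin 4) ≃*
      Multiplicative V ⋊[action permEquiv altLine] altLine) := by
  obtain ⟨f, hf⟩ := exists_injective_hom altLine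
  have hi := f.range.card_mul_index
  rw [← Nat.card_congr (f.ofInjective hf).toEquiv, card_semidirectProduct, card_altLine,
    card_perm_fin_four] at hi
  have : f.range = alternatingGroup (Fin 4) :=
    Equiv.Perm.eq_alternatingGroup_of_index_eq_two (by omega)
  exact ⟨((f.ofInjective hf).trans (MulEquiv.subgroupCongr this)).symm⟩

theorem nonempty_perm_mulEquiv :
    Nonempty (Equiv.Perm (Fin 4) ≃*
      Multiplicative V ⋊[action permEquiv ⊤] (⊤ : Subgroup (Equiv.Perm Line))) := by
  obtain ⟨f, hf⟩ := exists_injective_hom ⊤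
  refine ⟨(MulEquiv.ofBijective f
    ((Nat.bijective_iff_injective_and_card f).2 ⟨hf, ?_⟩)).symm⟩
  rw [card_semidirectProduct, Subgroup.card_top, card_perm_line, card_perm_fin_four]

end PlaneF2

/-! ### Normal closures and the Galois correspondence. -/

-- An element of the core fixes every conjugate of `K`, and the conjugates generate the normal
-- closure.
open IntermediateField in
theorem normalCore_fixingSubgroup_eq_bot {F L : Type*} [Field F] [Field L] [Algebra F L]
    [Normal F L] (K : IntermediateField F L) (h : normalClosure F K L = ⊤) :
    K.fixingSubgroup.normalCore = ⊥ := by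
  rw [eq_bot_iff]
  intro n hn
  rw [Subgroup.mem_bot]
  have h1 : ∀ x : L, x ∈ normalClosure F K L → n x = x := by
    suffices hle : normalClosure F K L ≤ fixedField (Subgroup.zpowers n) by
      intro x hx
      exact (mem_fixedField_iff _ _).1 (hle hx) n (Subgroup.mem_zpowers n)
    rw [normalClosure_def'']
    refine iSup_le fun g => ?_
    rw [le_iff_le, Subgroup.zpowers_le, IntermediateField.mem_fixingSubgroup_iff]
    rintro _ ⟨y, hy, rfl⟩
    have h2 := (IntermediateField.mem_fixingSubgroup_iff _ _).1 (hn g⁻¹) y hy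
    rw [inv_inv] at h2
    change g⁻¹ (n (g y)) = y at h2
    change n (g y) = g y
    rw [AlgEquiv.aut_inv, AlgEquiv.symm_apply_eq] at h2
    exact h2
  exact AlgEquiv.ext fun x => h1 x (h ▸ mem_top)

open IntermediateField in
theorem normalClosure_eq_top_of_normalCore_eq_bot {F L : Type*} [Field F] [Field L] [Algebra F L]
    [FiniteDimensional F L] [IsGalois F L] (K : IntermediateField F L)
    (h : K.fixingSubgroup.normalCore = ⊥) : normalClosure F K L = ⊤ := by
  have : IsGalois F (normalClosure F K L) := ⟨⟩
  -- The normal closure is normal over `F`, so its fixing subgroup is normal in the Galois group.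
  have h1 : (normalClosure F K L).fixingSubgroup ≤ K.fixingSubgroup.normalCore :=
    Subgroup.normal_le_normalCore.2 (fixingSubgroup_le (le_normalClosure K))
  rw [h, le_bot_iff] at h1
  rw [← IsGalois.fixedField_fixingSubgroup (normalClosure F K L), h1, fixedField_bot]

open IntermediateField in
theorem isNormalClosure_of_normalCore_eq_bot {F L : Type*} [Field F] [Field L] [Algebra F L]
    [FiniteDimensional F L] [IsGalois F L] (K : IntermediateField F L)
    (h : K.fixingSubgroup.normalCore = ⊥) : IsNormalClosure F K L := by
  rw [Algebra.IsAlgebraic.isNormalClosure_iff]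
  refine ⟨fun x => ?_, normalClosure_eq_top_of_normalCore_eq_bot K h⟩
  rw [← minpoly.algHom_eq K.val K.val.injective]
  exact Normal.splits inferInstance _

theorem isCoatom_fixingSubgroup_iff {F L : Type*} [Field F] [Field L] [Algebra F L]
    [FiniteDimensional F L] [IsGalois F L] (K : IntermediateField F L) :
    IsCoatom K.fixingSubgroup ↔ IsAtom K := by
  rw [← isAtom_dual_iff_isCoatom,
    ← OrderIso.isAtom_iff (IsGalois.intermediateFieldEquivSubgroup (F := F) (E := L)) K]
  rfl

theorem isAtom_iff_forall_eq_bot_or_eq_top {F L : Type*} [Field F] [Field L] [Algebra F L]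
    (K : IntermediateField F L) (hK : K ≠ ⊥) :
    IsAtom K ↔ ∀ M : IntermediateField F K, M = ⊥ ∨ M = ⊤ := by
  constructor
  · intro h M
    rcases h.le_iff.1 (IntermediateField.lift_le M) with h' | h'
    · left
      exact IntermediateField.lift_injective K (h'.trans (IntermediateField.lift_bot F K).symm)
    · right
      exact IntermediateField.lift_injective K (h'.trans (IntermediateField.lift_top F K).symm)
  · intro h
    refine ⟨hK, fun M hM => ?_⟩
    rw [← IntermediateField.lift_restrict hM.le]
    rcases h (IntermediateField.restrict hM.le) with h' | h'
    · rw [h', IntermediateField.lift_bot]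
    · have := IntermediateField.lift_restrict hM.le
      rw [h', IntermediateField.lift_top] at this
      exact absurd this hM.ne'

theorem isPrimitiveQuartic_iff_isCoatom {F L : Type*} [Field F] [Field L] [Algebra F L]
    [FiniteDimensional F L] [IsGalois F L] (K : IntermediateField F L)
    (hK : Module.finrank F K = 4) :
    IsPrimitiveQuartic F K ↔ IsCoatom K.fixingSubgroup := by
  have hb : K ≠ ⊥ := by
    rintro rfl
    rw [IntermediateField.finrank_bot] at hK
    omega
  rw [isCoatom_fixingSubgroup_iff, isAtom_iff_forall_eq_bot_or_eq_top K hb]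
  exact ⟨fun h => h.isPrimitive.eq_bot_or_eq_top,
    fun h => ⟨⟨inferInstance, inferInstance, by omega, h⟩, hK⟩⟩

theorem IsPrimitiveQuartic.of_algEquiv {F E E' : Type*} [Field F] [Field E] [Field E']
    [Algebra F E] [Algebra F E'] (e : E ≃ₐ[F] E') (h : IsPrimitiveQuartic F E) :
    IsPrimitiveQuartic F E' := by
  have := h.isPrimitive.finiteDimensional
  have := h.isPrimitive.isSeparable
  have hf := e.toLinearEquiv.finrank_eq
  refine ⟨⟨e.toLinearEquiv.finiteDimensional, Algebra.IsSeparable.of_algHom F E e.symm.toAlgHom,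
    hf ▸ h.isPrimitive.one_lt_finrank, fun K => ?_⟩, hf ▸ h.finrank_eq⟩
  rcases h.isPrimitive.eq_bot_or_eq_top (K.comap (e : E →ₐ[F] E')) with h' | h'
  · left
    rw [eq_bot_iff]
    intro x hx
    have : e.symm x ∈ K.comap (e : E →ₐ[F] E') := by
      change e (e.symm x) ∈ K
      rwa [e.apply_symm_apply]
    rw [h', IntermediateField.mem_bot] at this
    obtain ⟨y, hy⟩ := this
    rw [IntermediateField.mem_bot]
    exact ⟨y, by rw [← e.commutes, hy, e.apply_symm_apply]⟩
  · right
    rw [eq_top_iff]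
    intro x _
    have : e.symm x ∈ K.comap (e : E →ₐ[F] E') := h' ▸ IntermediateField.mem_top
    change e (e.symm x) ∈ K at this
    rwa [e.apply_symm_apply] at this

-- `L` is the compositum of the images of `E`, each of them separable.
open IntermediateField in
theorem IsNormalClosure.isGalois {F E L : Type*} [Field F] [Field E] [Field L]
    [Algebra F E] [Algebra F L] [FiniteDimensional F E] [Algebra.IsSeparable F E]
    [h : IsNormalClosure F E L] : IsGalois F L := by
  have : Normal F L := h.normal (F := F) (K := E)
  have ht := (Algebra.IsAlgebraic.isNormalClosure_iff.1 h).2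
  have hf (f : E →ₐ[F] L) : Algebra.IsSeparable F f.fieldRange :=
    Algebra.IsSeparable.of_algHom F E (AlgEquiv.ofInjectiveField f).symm.toAlgHom
  have h1 : Algebra.IsSeparable F (normalClosure F E L) :=
    IntermediateField.isSeparable_iSup F L (h := hf)
  rw [ht] at h1
  have : Algebra.IsSeparable F L :=
    Algebra.IsSeparable.of_algHom F _ (topEquiv (F := F) (E := L)).symm.toAlgHom
  exact ⟨⟩

open IntermediateField in
theorem IsNormalClosure.finiteDimensional {F E L : Type*} [Field F] [Field E] [Field L]
    [Algebra F E] [Algebra F L] [FiniteDimensional F E]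
    [h : IsNormalClosure F E L] : FiniteDimensional F L := by
  have ht := (Algebra.IsAlgebraic.isNormalClosure_iff.1 h).2
  have h1 : FiniteDimensional F (normalClosure F E L) := inferInstance
  rw [ht] at h1
  exact (topEquiv (F := F) (E := L)).toLinearEquiv.finiteDimensional

open IntermediateField in
theorem IsNormalClosure.exists_fixingSubgroup {F E L : Type*} [Field F] [Field E] [Field L]
    [Algebra F E] [Algebra F L] [FiniteDimensional F E] [FiniteDimensional F L] [IsGalois F L]
    [h : IsNormalClosure F E L] :
    ∃ K : IntermediateField F L, Nonempty (E ≃ₐ[F] K) ∧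
      K.fixingSubgroup.index = Module.finrank F E ∧ K.fixingSubgroup.normalCore = ⊥ := by
  obtain ⟨f⟩ : Nonempty (E →ₐ[F] L) :=
    nonempty_algHom_of_splits fun x => ⟨Algebra.IsIntegral.isIntegral x, h.splits x⟩
  let e : E ≃ₐ[F] f.fieldRange := AlgEquiv.ofInjectiveField f
  refine ⟨f.fieldRange, ⟨e⟩, ?_, ?_⟩
  · rw [← finrank_eq_fixingSubgroup_index, e.toLinearEquiv.finrank_eq]
  · apply normalCore_fixingSubgroup_eq_bot
    rw [← (Algebra.IsAlgebraic.isNormalClosure_iff.1 h).2]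
    -- Composing with `e` or its inverse matches the embeddings of `E` with those of its image, with
    -- the same ranges.
    refine le_antisymm (normalClosure_le_iff.2 fun g => ?_) (normalClosure_le_iff.2 fun g => ?_)
    · refine le_trans ?_ (AlgHom.fieldRange_le_normalClosure (g.comp e.toAlgHom))
      rintro _ ⟨x, rfl⟩
      exact ⟨e.symm x, congrArg g (e.apply_symm_apply x)⟩
    · refine le_trans ?_ (AlgHom.fieldRange_le_normalClosure (g.comp e.symm.toAlgHom))
      rintro _ ⟨x, rfl⟩
      exact ⟨e x, congrArg g (e.symm_apply_apply x)⟩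

/-! ### Primitive quartic extensions and their Galois groups. -/

theorem primitiveQuartic_iff_gal {F E L : Type*} [Field F] [Field E] [Field L]
    [Algebra F E] [Algebra F L] [Algebra.IsSeparable F E] (hE : Module.finrank F E = 4)
    [IsNormalClosure F E L] :
    (IsPrimitiveQuartic F E → Group.IsSolvable Gal(L/F)) ∧
    (IsPrimitiveQuartic F E ↔
      (Nonempty (Gal(L/F) ≃* alternatingGroup (Fin 4)) ∨
        Nonempty (Gal(L/F) ≃* Equiv.Perm (Fin 4)))) := by
  have : FiniteDimensional F E := Module.finite_of_finrank_eq_succ hE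
  have : FiniteDimensional F L := IsNormalClosure.finiteDimensional (E := E)
  have : IsGalois F L := IsNormalClosure.isGalois (E := E)
  obtain ⟨K, ⟨e⟩, hi, hc⟩ := IsNormalClosure.exists_fixingSubgroup (F := F) (E := E) (L := L)
  rw [hE] at hi
  have hp : IsPrimitiveQuartic F E ↔ IsCoatom K.fixingSubgroup := by
    rw [← isPrimitiveQuartic_iff_isCoatom K (by rw [← e.toLinearEquiv.finrank_eq, hE])]
    exact ⟨.of_algEquiv e, .of_algEquiv e.symm⟩
  rw [hp]
  constructor
  · intro _
    obtain ⟨f, hf⟩ := exists_injective_hom_perm_fin_four hi hc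
    have := isSolvable_perm_fin_four
    exact Group.isSolvable_of_isSolvable_injective hf
  · constructor
    · exact nonempty_mulEquiv_of_isCoatom hi hc
    · rintro (⟨⟨f⟩⟩ | ⟨⟨f⟩⟩)
      · exact Subgroup.isCoatom_of_mulEquiv f
          (fun _ => isCoatom_of_index_eq_four_alternatingGroup) hi
      · exact Subgroup.isCoatom_of_mulEquiv f (fun _ => isCoatom_of_index_eq_four_perm) hi

theorem exists_injective_transitive_hom {G : Type*} [Group G]
    (h : Nonempty (G ≃* alternatingGroup (Fin 4)) ∨ Nonempty (G ≃* Equiv.Perm (Fin 4))) :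
    ∃ f : G →* Equiv.Perm (Fin 4), Function.Injective f ∧ ∀ i : Fin 4, ∃ g, f g 0 = i := by
  rcases h with ⟨⟨e⟩⟩ | ⟨⟨e⟩⟩
  · refine ⟨(alternatingGroup (Fin 4)).subtype.comp e.toMonoidHom,
      (Subgroup.subtype_injective _).comp e.injective, fun i => ?_⟩
    obtain ⟨σ, hσ⟩ : ∃ σ : alternatingGroup (Fin 4), (σ : Equiv.Perm (Fin 4)) 0 = i := by
      revert i
      decide
    exact ⟨e.symm σ, by simpa using hσ⟩
  · exact ⟨e.toMonoidHom, e.injective, fun i => ⟨e.symm (Equiv.swap 0 i), by simp⟩⟩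

theorem exists_unique_primitiveQuartic (F : Type u) [Field F] (D : Type w) [Field D] [Algebra F D]
    (hD : IsGaloisWithGroup F D (alternatingGroup (Fin 4)) ∨
      IsGaloisWithGroup F D (Equiv.Perm (Fin 4))) :
    ∃ E : IntermediateField F D, IsPrimitiveQuartic F E ∧ IsNormalClosure F E D ∧
      ∀ (E' : Type v) [Field E'] [Algebra F E'],
        IsPrimitiveQuartic F E' → IsNormalClosure F E' D → Nonempty (E' ≃ₐ[F] E) := by
  have hG : IsGalois F D := hD.elim (·.isGalois) (·.isGalois)
  have hS := hD.imp (·.nonempty_mulEquiv) (·.nonempty_mulEquiv)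
  obtain ⟨f, hf, ht⟩ := exists_injective_transitive_hom hS
  have : Finite Gal(D/F) := Finite.of_injective f hf
  have : FiniteDimensional F D := IsGalois.finiteDimensional_of_finite F D
  obtain ⟨H, hi, hc⟩ := exists_subgroup_index_four f hf ht
  obtain ⟨K, rfl⟩ : ∃ K : IntermediateField F D, K.fixingSubgroup = H :=
    ⟨_, IntermediateField.fixingSubgroup_fixedField H⟩
  have hn : IsNormalClosure F K D := isNormalClosure_of_normalCore_eq_bot K hc
  have h4 : Module.finrank F K = 4 := by
    rw [IntermediateField.finrank_eq_fixingSubgroup_index, hi]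
  have hp : IsPrimitiveQuartic F K := (primitiveQuartic_iff_gal (L := D) h4).2.2 hS
  refine ⟨K, hp, hn, fun E' _ _ hp' hn' => ?_⟩
  have := hp'.isPrimitive.finiteDimensional
  obtain ⟨K', ⟨e⟩, hi', hc'⟩ := IsNormalClosure.exists_fixingSubgroup (F := F) (E := E') (L := D)
  rw [hp'.finrank_eq] at hi'
  have hpK' := hp'.of_algEquiv e
  -- An automorphism conjugating the two fixing subgroups carries `K'` onto `K`.
  obtain ⟨g, hg⟩ := exists_conj_smul_eq_of_isCoatom hi' hc'
    ((isPrimitiveQuartic_iff_isCoatom K' hpK'.finrank_eq).1 hpK') hi hc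
    ((isPrimitiveQuartic_iff_isCoatom K h4).1 hp)
  rw [← IsGalois.map_fixingSubgroup] at hg
  have hK : K'.map (g : D →ₐ[F] D) = K := by
    rw [← IsGalois.fixedField_fixingSubgroup K, ← hg, IsGalois.fixedField_fixingSubgroup]
  exact ⟨e.trans ((IntermediateField.intermediateFieldMap g K').trans
    (IntermediateField.equivOfEq hK))⟩

theorem mainTheorem7 (F : Type u) [Field F] :
    -- primitive quartic extensions are the quartic ones with group `A₄` or `S₄`
    (∀ (E : Type v) [Field E] [Algebra F E] [Algebra.IsSeparable F E],
      Module.finrank F E = 4 →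
      ∀ (L : Type w) [Field L] [Algebra F L] [IsNormalClosure F E L],
        (IsPrimitiveQuartic F E → Group.IsSolvable Gal(L/F)) ∧
        (IsPrimitiveQuartic F E ↔
          (Nonempty (Gal(L/F) ≃* alternatingGroup (Fin 4)) ∨
            Nonempty (Gal(L/F) ≃* Equiv.Perm (Fin 4))))) ∧
    -- `A₄ = 𝔽₂² ⋊ A₃` and `S₄ = 𝔽₂² ⋊ S₃`, where `S₃` is `GL₂(𝔽₂)` permuting the three lines
    (Nat.card PlaneF2.Line = 3 ∧
      ∃ e : PlaneF2.GL2 ≃* Equiv.Perm PlaneF2.Line,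
        (∀ (g : PlaneF2.GL2) (p : PlaneF2.Line), e g p = g • p) ∧
        (∀ H : Subgroup (Equiv.Perm PlaneF2.Line),
          (PlaneF2.rep e H).IsIrreducible ↔ H = PlaneF2.altLine ∨ H = ⊤) ∧
        Nonempty (alternatingGroup (Fin 4) ≃*
          Multiplicative PlaneF2.V ⋊[PlaneF2.action e PlaneF2.altLine] PlaneF2.altLine) ∧
        Nonempty (Equiv.Perm (Fin 4) ≃*
          Multiplicative PlaneF2.V ⋊[PlaneF2.action e ⊤]
            (⊤ : Subgroup (Equiv.Perm PlaneF2.Line)))) ∧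
    -- every `A₄`- or `S₄`-extension is the closure of a unique primitive quartic extension
    (∀ (D : Type w) [Field D] [Algebra F D],
      (IsGaloisWithGroup F D (alternatingGroup (Fin 4)) ∨
        IsGaloisWithGroup F D (Equiv.Perm (Fin 4))) →
      ∃ E : IntermediateField F D, IsPrimitiveQuartic F E ∧ IsNormalClosure F E D ∧
        ∀ (E' : Type v) [Field E'] [Algebra F E'],
          IsPrimitiveQuartic F E' → IsNormalClosure F E' D → Nonempty (E' ≃ₐ[F] E)) := by
  exact ⟨fun E _ _ _ hE L _ _ _ => primitiveQuartic_iff_gal hE,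
    ⟨PlaneF2.card_line, PlaneF2.permEquiv, PlaneF2.permEquiv_apply, PlaneF2.isIrreducible_iff,
      PlaneF2.nonempty_alternatingGroup_mulEquiv, PlaneF2.nonempty_perm_mulEquiv⟩,
    fun D _ _ hD => exists_unique_primitiveQuartic F D hD⟩
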